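/- Let $n\ge 1$ and $m\ge 2$ be integers, $[n]=\{1,\dots,n\}$, and let $e_1,\dots,e_n$ be the standard basis of $\mathbb R^n$. The H-cycle polytope $H_{n,m}\subset\mathbb R^{n^m}$ is the set of all $y=(y_{i_1 i_2\cdots i_m})_{(i_1,\dots,i_m)\in[n]^m}$ with $$\sum_{(i_1,\dots,i_m)\in[n]^m} y_{i_1\cdots i_m}\bigl((m-1)e_{i_1}-e_{i_2}-\cdots-e_{i_m}\bigr)=0,\qquad \sum_{(i_1,\dots,i_m)\in[n]^m} y_{i_1\cdots i_m}=1,\qquad y_{i_1\cdots i_m}\ge 0 .$$ 1. If $y$ is a vertex (extreme point) of $H_{n,m}$, then for each $j\in[n]$ at most one of the entries $y_{j i_2\cdots i_m}$, $(i_2,\dots,i_m)\in[n]^{m-1}$, is nonzero. 2. There exist vertices of $H_{n,m}$ with exactly $n$ nonzero entries. 3. An example is given by the periodic sequence $s=(1,2,\dots,n,1,2,\dots,n,\dots)$: the point with entry $\frac1n$ at each of the positions $(s_j,s_{j+1},\dots,s_{j+m-1})$, $j=1,\dots,n$, and all other entries $0$, is a vertex of $H_{n,m}$ with exactly $n$ nonzero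 entries. -/

import Mathlib

open Finset

noncomputable section

/-- The vector `(m-1) e_{i₁} - e_{i₂} - ⋯ - e_{i_m}` of `ℝⁿ` attached to a position
`(i₁, …, i_m) ∈ [n]^m`. Positions are functions `i : Fin m → Fin n`, and `i 0` is the first
index `i₁`. -/
def edgeVector {n m : ℕ} [NeZero m] (i : Fin m → Fin n) : Fin n → ℝ :=
  ((m : ℝ) - 1) • Pi.single (i 0) (1 : ℝ) - ∑ k ∈ univ.erase (0 : Fin m), Pi.single (i k) (1 : ℝ)

/-- The H-cycle polytope `H_{n,m}` in `ℝ^{n^m}`. -/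
def hCyclePolytope (n m : ℕ) [NeZero m] : Set ((Fin m → Fin n) → ℝ) :=
  {y | ∑ i, y i • edgeVector i = 0 ∧ ∑ i, y i = 1 ∧ ∀ i, 0 ≤ y i}

/-- The vertices of `H_{n,m}` (the fundamental H-cycles): its extreme points. -/
def hCycleVertices (n m : ℕ) [NeZero m] : Set ((Fin m → Fin n) → ℝ) :=
  Set.extremePoints ℝ (hCyclePolytope n m)

/-- The position `(j, j+1, …, j+m-1)`, with entries read cyclically modulo `n`, i.e. `m`
consecutive terms of the periodic sequence that runs through all `n` indices in order. -/
def cyclicEdge (n m : ℕ) [NeZero n] (j : Fin n) : Fin m → Fin n :=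
  fun k => j + Fin.ofNat n (k : ℕ)

open Classical in
/-- The point of `ℝ^{n^m}` with entry `1/n` at the `n` cyclic positions and `0` elsewhere. -/
def cyclicPoint (n m : ℕ) [NeZero n] : (Fin m → Fin n) → ℝ :=
  fun i => if ∃ j : Fin n, i = cyclicEdge n m j then 1 / (n : ℝ) else 0

end

/-! Let `S` be the support of a vertex and `J` the set of first indices occurring in `S`.
Extremality makes the constraint columns over `S` independent (`eq_zero_of_mem_hCycleVertices`),
while balance rows outside `J` vanish on `S` (`edgeVector_eq_zero_of_mem`). Since the balance rows
sum to zero, normalization can be absorbed into the `J` rows, so `|S| ≤ |J|` and first indices are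
distinct on `S`. For the cyclic point, balance says that each weight is the average of the `m - 1`
preceding ones, so a maximum principle makes the weights constant (`eq_of_sum_sub_eq_zero`). -/

theorem edgeVector_apply {n m : ℕ} [NeZero m] (i : Fin m → Fin n) (c : Fin n) :
    edgeVector i c = ((m : ℝ) - 1) * (if i 0 = c then 1 else 0) -
      ∑ k ∈ univ.erase (0 : Fin m), (if i k = c then 1 else 0) := by
  simp only [edgeVector, Pi.sub_apply, Pi.smul_apply, Finset.sum_apply, Pi.single_apply,
    smul_eq_mul, eq_comm (a := c)]

theorem card_univ_erase_zero (m : ℕ) [NeZero m] :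
    ((univ.erase (0 : Fin m)).card : ℝ) = (m : ℝ) - 1 := by
  rw [card_erase_of_mem (mem_univ _), card_univ, Fintype.card_fin,
    Nat.cast_sub (NeZero.one_le), Nat.cast_one]

theorem sum_edgeVector {n m : ℕ} [NeZero m] (i : Fin m → Fin n) :
    ∑ c, edgeVector i c = 0 := by
  simp only [edgeVector_apply, sum_sub_distrib, ← mul_sum]
  rw [sum_comm]
  simp only [sum_ite_eq, mem_univ, if_true, sum_const, nsmul_eq_mul, card_univ_erase_zero]
  ring

theorem edgeVector_nonpos {n m : ℕ} [NeZero m] {i : Fin m → Fin n} {c : Fin n} (h : i 0 ≠ c) :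
    edgeVector i c ≤ 0 := by
  rw [edgeVector_apply, if_neg h, mul_zero, zero_sub, neg_nonpos]
  exact sum_nonneg fun k _ => by split_ifs <;> norm_num

/-- An index that is never the first one of a position in the support of `y` is not an index of
such a position at all. -/
theorem edgeVector_eq_zero_of_mem {n m : ℕ} [NeZero m] {y : (Fin m → Fin n) → ℝ}
    (hy : y ∈ hCyclePolytope n m) {c : Fin n} (hc : ∀ i, y i ≠ 0 → i 0 ≠ c)
    {i : Fin m → Fin n} (hi : y i ≠ 0) : edgeVector i c = 0 := by
  obtain ⟨hbal, -, hnn⟩ := hy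
  have hle : ∀ i ∈ univ, y i * edgeVector i c ≤ 0 := by
    intro i _
    by_cases h : y i = 0
    · simp [h]
    · exact mul_nonpos_of_nonneg_of_nonpos (hnn i) (edgeVector_nonpos (hc i h))
  have hsum : ∑ i, y i * edgeVector i c = 0 := by
    simpa [Finset.sum_apply] using congrFun hbal c
  have := (sum_eq_zero_iff_of_nonpos hle).1 hsum i (mem_univ _)
  exact (mul_eq_zero.1 this).resolve_left hi

/-- The columns of the constraint matrix in the support of a vertex are linearly independent. -/
theorem eq_zero_of_mem_hCycleVertices {n m : ℕ} [NeZero m] {y z : (Fin m → Fin n) → ℝ}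
    (hy : y ∈ hCycleVertices n m) (hz : ∀ i, y i = 0 → z i = 0)
    (hbal : ∑ i, z i • edgeVector i = 0) (hsum : ∑ i, z i = 0) : z = 0 := by
  obtain ⟨⟨ybal, ysum, ynn⟩, hext⟩ := mem_extremePoints.1 hy
  -- A small `ε` keeps both `y + ε z` and `y - ε z` in the polytope; `y` is their midpoint.
  obtain ⟨ε, hε, hεz⟩ : ∃ ε : ℝ, 0 < ε ∧ ∀ i, ε * |z i| ≤ y i := by
    have h : ∀ᶠ ε in nhdsWithin (0 : ℝ) (Set.Ioi 0), ∀ i, ε * |z i| ≤ y i := by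
      refine Filter.eventually_all.2 fun i => ?_
      rcases (ynn i).eq_or_lt with h | h
      · simp [hz i h.symm, ← h]
      · have ht : Filter.Tendsto (fun ε : ℝ => ε * |z i|) (nhdsWithin 0 (Set.Ioi 0)) (nhds 0) := by
          have : Continuous fun ε : ℝ => ε * |z i| := by fun_prop
          simpa using (this.tendsto 0).mono_left nhdsWithin_le_nhds
        exact (ht.eventually_lt_const h).mono fun _ => le_of_lt
    obtain ⟨ε, h1, h2⟩ := (h.and self_mem_nhdsWithin).exists
    exact ⟨ε, h2, h1⟩
  have key : ∀ t : ℝ, |t| = ε → y + t • z ∈ hCyclePolytope n m := by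
    intro t ht
    refine ⟨?_, ?_, fun i => ?_⟩
    · simp only [Pi.add_apply, Pi.smul_apply, smul_eq_mul, add_smul, mul_smul, sum_add_distrib,
        ← smul_sum, ybal, hbal, smul_zero, add_zero]
    · simp only [Pi.add_apply, Pi.smul_apply, smul_eq_mul, sum_add_distrib, ← mul_sum, ysum, hsum,
        mul_zero, add_zero]
    · have h1 := hεz i
      have h2 := neg_abs_le (t * z i)
      rw [abs_mul, ht] at h2
      simp only [Pi.add_apply, Pi.smul_apply, smul_eq_mul]
      linarith
  have h := (hext _ (key ε (abs_of_pos hε)) _ (key (-ε) (by rw [abs_neg, abs_of_pos hε]))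
    ⟨1 / 2, 1 / 2, by norm_num, by norm_num, by norm_num, by module⟩).1
  exact (smul_eq_zero.1 (add_eq_left.1 h)).resolve_left hε.ne'

theorem injOn_support_of_mem_hCycleVertices {n m : ℕ} [NeZero m] {y : (Fin m → Fin n) → ℝ}
    (hy : y ∈ hCycleVertices n m) : Set.InjOn (fun i : Fin m → Fin n => i 0) {i | y i ≠ 0} := by
  classical
  set S : Finset (Fin m → Fin n) := univ.filter fun i => y i ≠ 0 with hS
  set J : Finset (Fin n) := S.image fun i => i 0 with hJ
  have hedge : ∀ i ∈ S, ∀ c ∉ J, edgeVector i c = 0 := fun i hi c hc =>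
    edgeVector_eq_zero_of_mem hy.1
      (fun i' hi' h => hc (mem_image.2 ⟨i', by simpa [hS] using hi', h⟩))
      (by simpa [hS] using hi)
  -- The `1 +` adds the normalization row to each balance row, so only `|J|` equations are needed
  -- instead of `|J| + 1`.
  let L : (S → ℝ) →ₗ[ℝ] (J → ℝ) :=
    { toFun := fun z c => ∑ i, z i * (1 + edgeVector i.1 c.1)
      map_add' := fun z w => by ext c; simp [add_mul, sum_add_distrib]
      map_smul' := fun t z => by ext c; simp [mul_sum, mul_assoc] }
  have hinj : Function.Injective L := by
    refine (injective_iff_map_eq_zero L).2 fun z hz => ?_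
    have hz' : ∀ c ∈ J, ∑ i, z i + ∑ i, z i * edgeVector i.1 c = 0 := by
      intro c hc
      rw [← sum_add_distrib]
      simpa [L, mul_add] using congrFun hz ⟨c, hc⟩
    -- Summing the `J` rows cancels the balance parts and leaves `|J| * ∑ z = 0`.
    have hsum : ∑ i, z i = 0 := by
      have h1 : ∑ c ∈ J, (∑ i, z i + ∑ i, z i * edgeVector i.1 c) = 0 := sum_eq_zero hz'
      have h2 : ∑ c ∈ J, ∑ i, z i * edgeVector i.1 c = 0 := by
        rw [sum_comm]
        refine sum_eq_zero fun i _ => ?_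
        rw [← mul_sum, sum_subset (subset_univ J) fun c _ hc => hedge i.1 i.2 c hc,
          sum_edgeVector, mul_zero]
      rw [sum_add_distrib, h2, add_zero, sum_const, nsmul_eq_mul] at h1
      by_cases hne : J = ∅
      · have : S = ∅ := image_eq_empty.1 hne
        exact sum_eq_zero fun i _ => absurd i.2 (by simp [this])
      · exact (mul_eq_zero.1 h1).resolve_left (by simpa using hne)
    let w : (Fin m → Fin n) → ℝ := fun i => if h : i ∈ S then z ⟨i, h⟩ else 0
    have hw : ∀ i : S, w i = z i := fun i => by simp [w]
    have hw0 : ∀ i ∉ S, w i = 0 := fun i hi => by simp [w, hi]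
    have hwsum : ∀ f : (Fin m → Fin n) → ℝ, ∑ i, w i * f i = ∑ i : S, z i * f i := by
      intro f
      rw [← sum_subset (subset_univ S) fun i _ hi => by rw [hw0 i hi, zero_mul], ← sum_coe_sort S]
      exact sum_congr rfl fun i _ => by rw [hw]
    have hw_eq : w = 0 := by
      refine eq_zero_of_mem_hCycleVertices hy (fun i hi => hw0 i (by simp [hS, hi])) ?_ ?_
      · ext c
        simp only [Finset.sum_apply, Pi.smul_apply, smul_eq_mul, Pi.zero_apply]
        rw [hwsum fun i => edgeVector i c]
        by_cases hc : c ∈ J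
        · simpa only [hsum, zero_add] using hz' c hc
        · exact sum_eq_zero fun i _ => by rw [hedge i.1 i.2 c hc, mul_zero]
      · simpa only [mul_one, hsum] using hwsum fun _ => 1
    ext i
    rw [← hw, hw_eq]
    rfl
  have hcard : S.card ≤ J.card := by
    simpa using LinearMap.finrank_le_finrank_of_injective hinj
  have := card_image_iff.1 (le_antisymm card_image_le hcard)
  simpa [hS] using this

/-- By nonnegativity, the endpoints of a segment through `y` vanish wherever `y` does. -/
theorem mem_hCycleVertices_of_unique {n m : ℕ} [NeZero m] {y : (Fin m → Fin n) → ℝ}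
    (hy : y ∈ hCyclePolytope n m)
    (h : ∀ x ∈ hCyclePolytope n m, (∀ i, y i = 0 → x i = 0) → x = y) :
    y ∈ hCycleVertices n m := by
  refine mem_extremePoints_iff_left.2 ⟨hy, fun x hx x' hx' ⟨a, b, ha, hb, _, hab⟩ => h x hx ?_⟩
  intro i hi
  have h1 : a * x i + b * x' i = 0 := by simpa [hi] using congrFun hab i
  have h2 := mul_nonneg ha.le (hx.2.2 i)
  have h3 := mul_nonneg hb.le (hx'.2.2 i)
  exact (mul_eq_zero.1 (by linarith : a * x i = 0)).resolve_left ha.ne'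

theorem cyclicEdge_zero {n m : ℕ} [NeZero n] [NeZero m] (j : Fin n) :
    cyclicEdge n m j 0 = j := by
  simp [cyclicEdge]

theorem cyclicEdge_injective (n m : ℕ) [NeZero n] [NeZero m] :
    Function.Injective (cyclicEdge n m) := fun a b h => by
  simpa only [cyclicEdge_zero] using congrFun h 0

theorem sum_mul_eq_sum_cyclicEdge {n m : ℕ} [NeZero n] [NeZero m] {x : (Fin m → Fin n) → ℝ}
    (hx : ∀ i, i ∉ Set.range (cyclicEdge n m) → x i = 0) (f : (Fin m → Fin n) → ℝ) :
    ∑ i, x i * f i = ∑ j, x (cyclicEdge n m j) * f (cyclicEdge n m j) :=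
  (Fintype.sum_of_injective _ (cyclicEdge_injective n m) _ _
    (fun i hi => by rw [hx i hi, zero_mul]) fun _ => rfl).symm

theorem sum_mul_edgeVector_cyclicEdge {n m : ℕ} [NeZero n] [NeZero m] (u : Fin n → ℝ)
    (c : Fin n) :
    ∑ j, u j * edgeVector (cyclicEdge n m j) c =
      ∑ k ∈ univ.erase (0 : Fin m), (u c - u (c - Fin.ofNat n (k : ℕ))) := by
  simp only [edgeVector_apply, cyclicEdge_zero, mul_sub, sum_sub_distrib, mul_sum, sum_const,
    nsmul_eq_mul, card_univ_erase_zero]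
  rw [sum_comm]
  congr 1
  · simp [mul_comm]
  · refine sum_congr rfl fun k _ => ?_
    simp [cyclicEdge, ← eq_sub_iff_add_eq]

theorem cyclicPoint_cyclicEdge {n m : ℕ} [NeZero n] (j : Fin n) :
    cyclicPoint n m (cyclicEdge n m j) = 1 / (n : ℝ) :=
  if_pos ⟨j, rfl⟩

theorem cyclicPoint_of_notMem {n m : ℕ} [NeZero n] {i : Fin m → Fin n}
    (hi : i ∉ Set.range (cyclicEdge n m)) : cyclicPoint n m i = 0 :=
  if_neg fun ⟨j, hj⟩ => hi ⟨j, hj.symm⟩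

theorem cyclicPoint_mem_hCyclePolytope (n m : ℕ) [NeZero n] [NeZero m] :
    cyclicPoint n m ∈ hCyclePolytope n m := by
  refine ⟨?_, ?_, fun i => ?_⟩
  · ext c
    simp only [Finset.sum_apply, Pi.smul_apply, smul_eq_mul, Pi.zero_apply]
    rw [sum_mul_eq_sum_cyclicEdge (fun i => cyclicPoint_of_notMem) fun i => edgeVector i c,
      sum_mul_edgeVector_cyclicEdge fun j => cyclicPoint n m (cyclicEdge n m j)]
    simp [cyclicPoint_cyclicEdge]
  · have := sum_mul_eq_sum_cyclicEdge (x := cyclicPoint n m)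
      (fun i => cyclicPoint_of_notMem) fun _ => 1
    simpa [cyclicPoint_cyclicEdge] using this
  · unfold cyclicPoint
    split_ifs <;> positivity

/-- The maximum principle on the cycle. -/
theorem eq_of_sum_sub_eq_zero {n m : ℕ} [NeZero n] [NeZero m] (hm : 2 ≤ m) {u : Fin n → ℝ}
    (hu : ∀ c, ∑ k ∈ univ.erase (0 : Fin m), (u c - u (c - Fin.ofNat n (k : ℕ))) = 0)
    (a b : Fin n) : u a = u b := by
  obtain ⟨c, hc⟩ := Finite.exists_max u
  -- At a maximum all summands are nonnegative, hence zero; `2 ≤ m` provides the term `k = 1`, and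
  -- unit steps reach every index.
  have hstep : ∀ d, u d = u c → u (d - Fin.ofNat n 1) = u c := by
    intro d hd
    have h := (sum_eq_zero_iff_of_nonneg fun k _ => by rw [hd]; exact sub_nonneg.2 (hc _)).1 (hu d)
      ⟨1, hm⟩ (by simp [Fin.ext_iff])
    rw [← hd]
    exact (sub_eq_zero.1 h).symm
  have hall : ∀ k : ℕ, u (c - Fin.ofNat n k) = u c := by
    intro k
    induction k with
    | zero => simp
    | succ k ih =>
      have h := hstep _ ih
      have hadd : Fin.ofNat n (k + 1) = Fin.ofNat n k + Fin.ofNat n 1 := by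
        ext
        simp [Fin.val_add]
      rwa [sub_sub, ← hadd] at h
  have h : ∀ d, u d = u c := fun d => by
    have := hall (c - d : Fin n)
    simpa using this
  rw [h a, h b]

theorem cyclicPoint_mem_hCycleVertices {n m : ℕ} [NeZero n] [NeZero m] (hm : 2 ≤ m) :
    cyclicPoint n m ∈ hCycleVertices n m := by
  refine mem_hCycleVertices_of_unique (cyclicPoint_mem_hCyclePolytope n m) fun x hx hsupp => ?_
  have hx0 : ∀ i, i ∉ Set.range (cyclicEdge n m) → x i = 0 :=
    fun i hi => hsupp i (cyclicPoint_of_notMem hi)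
  have hconst := eq_of_sum_sub_eq_zero hm (u := fun j => x (cyclicEdge n m j)) fun c => by
    rw [← sum_mul_edgeVector_cyclicEdge fun j => x (cyclicEdge n m j),
      ← sum_mul_eq_sum_cyclicEdge hx0 fun i => edgeVector i c]
    simpa [Finset.sum_apply] using congrFun hx.1 c
  ext i
  by_cases hi : i ∈ Set.range (cyclicEdge n m)
  · obtain ⟨j, rfl⟩ := hi
    have h := sum_mul_eq_sum_cyclicEdge hx0 fun _ => 1
    simp only [mul_one, hx.2.1] at h
    rw [sum_congr rfl fun k _ => hconst k j, sum_const, card_univ, Fintype.card_fin,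
      nsmul_eq_mul] at h
    rw [cyclicPoint_cyclicEdge, eq_div_iff (NeZero.ne _), mul_comm, ← h]
  · rw [hx0 i hi, cyclicPoint_of_notMem hi]

theorem ncard_support_cyclicPoint (n m : ℕ) [NeZero n] [NeZero m] :
    {i : Fin m → Fin n | cyclicPoint n m i ≠ 0}.ncard = n := by
  have h : {i : Fin m → Fin n | cyclicPoint n m i ≠ 0} = Set.range (cyclicEdge n m) := by
    ext i
    refine ⟨fun hi => by_contra fun h => hi (cyclicPoint_of_notMem h), ?_⟩
    rintro ⟨j, rfl⟩
    simpa [cyclicPoint_cyclicEdge] using NeZero.ne n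
  rw [h, ← Set.image_univ, Set.ncard_image_of_injective _ (cyclicEdge_injective n m),
    Set.ncard_univ, Nat.card_eq_fintype_card, Fintype.card_fin]

theorem mainTheorem4 (n m : ℕ) [NeZero n] [NeZero m] (hm : 2 ≤ m) :
    (∀ y ∈ hCycleVertices n m, ∀ j : Fin n,
      {i : Fin m → Fin n | i 0 = j ∧ y i ≠ 0}.Subsingleton) ∧
    (∃ y ∈ hCycleVertices n m, {i : Fin m → Fin n | y i ≠ 0}.ncard = n) ∧
    (cyclicPoint n m ∈ hCycleVertices n m ∧
      {i : Fin m → Fin n | cyclicPoint n m i ≠ 0}.ncard = n) := by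
  have hv : cyclicPoint n m ∈ hCycleVertices n m := cyclicPoint_mem_hCycleVertices hm
  have hc := ncard_support_cyclicPoint n m
  exact ⟨fun y hy j i hi i' hi' =>
    injOn_support_of_mem_hCycleVertices hy hi.2 hi'.2 (hi.1.trans hi'.1.symm),
    ⟨_, hv, hc⟩, hv, hc⟩
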